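/- Let $\{0,1\}^*$ be the rooted binary tree of finite words over the alphabet $\{0,1\}=\mathbb Z_2$, and let $\operatorname{Aut}(\{0,1\}^*)$ be its automorphism group, where in a product $gh$ the automorphism $g$ acts first. Write $g=(g_0,g_1)\sigma^{\varepsilon}$ for the automorphism with $g(iv)=\sigma^{\varepsilon}(i)\,g_i(v)$ for every letter $i$ and every word $v$, where $\sigma$ is the transposition of $0$ and $1$. Let $\mathcal G=\langle a,b,c,d\rangle$ be the group generated by the four states of the automaton \[a=(d,d)\sigma,\qquad b=(c,c),\qquad c=(a,b),\qquad d=(b,a),\] and put $x=ab$, $y=cd$, $t=ac$. Write $g^h=h^{-1}gh$. Let $\mathbb Z_2^2\wr\mathbb Z=\bigl(\bigoplus_{\mathbb Z}\mathbb Z_2^2\bigr)\rtimes\mathbb Z$ denote the restricted wreath product (the lamplighter group of rank $2$). Then: 1. $x^a=x$, $y^a=y^{t^{-1}}$ and $t^a=t^{-1}$. 2. The subgroup $\langle x,y,t\rangle$ of $\mathcal G$ is isomorphic to $\mathbb Z_2^2\wr\mathbb Z=\langle x,y\rangle\wr\langle t\rangle$, by an isomorphism under which $x,y$ correspond to the standard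 generators of the copy of $\mathbb Z_2^2$ with index $0$ and $t$ corresponds to the standard generator of $\mathbb Z$. 3. $\mathcal G\cong(\mathbb Z_2^2\wr\mathbb Z)\rtimes\mathbb Z_2=\bigl(\langle x,y\rangle\wr\langle t\rangle\bigr)\rtimes\langle a\rangle$, where the generator of $\mathbb Z_2$ corresponds to $a$ and acts on the standard generators $x,y,t$ of $\mathbb Z_2^2\wr\mathbb Z$ by $x\mapsto x$, $y\mapsto tyt^{-1}$, $t\mapsto t^{-1}$. 4. The subgroup $\langle x,y,t\rangle$ has index $2$ in $\mathcal G$ and consists of affine automorphisms, i.e. each of its elements acts on the boundary $\mathbb Z_2^\infty$ of the tree by $\mathbf x\mapsto \mathbf b+\mathbf x A$ for some infinite upper triangular matrix $A$ over $\mathbb Z_2$ with units on the diagonal and some $\mathbf b\in\mathbb Z_2^\infty$. -/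

import Mathlib

/-! ### The rooted tree of words, its automorphism group, and Mealy automata -/

/-- The rooted tree `X^*`: its vertices are the finite words over `X`, and `v` is adjacent to `vx`
for every word `v` and every letter `x`. -/
def wordTree (X : Type*) : SimpleGraph (List X) where
  Adj u v := (∃ x : X, v = u ++ [x]) ∨ (∃ x : X, u = v ++ [x])
  symm := ⟨fun _ _ h => h.symm⟩
  loopless := ⟨fun u h => by
    rcases h with ⟨x, hx⟩ | ⟨x, hx⟩ <;> simpa using congrArg List.length hx⟩

/-- The group `Aut(X^*)` of graph automorphisms of `X^*`, with the convention that in a product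
`g * h` the automorphism `g` acts first (whence the opposite of the group of graph isomorphisms,
whose product is composition of functions). -/
abbrev TreeAut (X : Type*) : Type _ := (wordTree X ≃g wordTree X)ᵐᵒᵖ

/-- The image `g(v)` of the word `v` under the tree automorphism `g`. -/
def TreeAut.app {X : Type*} (g : TreeAut X) (v : List X) : List X := g.unop v

/-- In a product `g * h` the automorphism `g` acts first. -/
theorem TreeAut.mul_app {X : Type*} (g h : TreeAut X) (v : List X) :
    (g * h).app v = h.app (g.app v) := rfl

/-- An invertible Mealy automaton with set of states `Q` over the alphabet `X`: a transition
function, and an output function which at every state is a permutation of `X`. -/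
structure InvertibleAutomaton (Q X : Type*) where
  /-- the transition function -/
  next : Q → X → Q
  /-- the output function -/
  out : Q → Equiv.Perm X

namespace InvertibleAutomaton

variable {Q X : Type*} (A : InvertibleAutomaton Q X)

/-- The transformation of `X^*` induced by the initial automaton with initial state `q`. -/
def run : Q → List X → List X
  | _, [] => []
  | q, x :: v => A.out q x :: run (A.next q x) v

/-- The inverse transformation. -/
def runInv : Q → List X → List X
  | _, [] => []
  | q, x :: v => (A.out q).symm x :: runInv (A.next q ((A.out q).symm x)) v

theorem runInv_run (q : Q) (v : List X) : A.runInv q (A.run q v) = v := by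
  induction v generalizing q with
  | nil => rfl
  | cons x v ih => simp [run, runInv, ih]

theorem run_runInv (q : Q) (v : List X) : A.run q (A.runInv q v) = v := by
  induction v generalizing q with
  | nil => rfl
  | cons x v ih => simp [run, runInv, ih]

theorem exists_run_append (q : Q) (v : List X) (x : X) :
    ∃ y : X, A.run q (v ++ [x]) = A.run q v ++ [y] := by
  induction v generalizing q with
  | nil => exact ⟨A.out q x, rfl⟩
  | cons z v ih =>
    obtain ⟨y, hy⟩ := ih (A.next q z)
    exact ⟨y, by simp [run, hy]⟩

theorem exists_runInv_append (q : Q) (v : List X) (x : X) :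
    ∃ y : X, A.runInv q (v ++ [x]) = A.runInv q v ++ [y] := by
  induction v generalizing q with
  | nil => exact ⟨(A.out q).symm x, rfl⟩
  | cons z v ih =>
    obtain ⟨y, hy⟩ := ih (A.next q ((A.out q).symm z))
    exact ⟨y, by simp [runInv, hy]⟩

/-- The automorphism of the tree `X^*` induced by the initial automaton with initial state `q`. -/
def aut (q : Q) : TreeAut X := MulOpposite.op
  { toFun := A.run q
    invFun := A.runInv q
    left_inv := A.runInv_run q
    right_inv := A.run_runInv q
    map_rel_iff' := by
      intro u v
      constructor
      · intro h
        rw [← A.runInv_run q u, ← A.runInv_run q v]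
        rcases h with ⟨x, hx⟩ | ⟨x, hx⟩
        · left
          obtain ⟨y, hy⟩ := A.exists_runInv_append q (A.run q u) x
          exact ⟨y, (congrArg _ hx).trans hy⟩
        · right
          obtain ⟨y, hy⟩ := A.exists_runInv_append q (A.run q v) x
          exact ⟨y, (congrArg _ hx).trans hy⟩
      · rintro (⟨x, rfl⟩ | ⟨x, rfl⟩)
        · exact Or.inl (A.exists_run_append q _ x)
        · exact Or.inr (A.exists_run_append q _ x) }

theorem aut_app (q : Q) (v : List X) : (A.aut q).app v = A.run q v := rfl

/-- The automaton group: the group generated by all the states of the automaton, viewed as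
automorphisms of the tree. -/
def group : Subgroup (TreeAut X) := Subgroup.closure (Set.range A.aut)

end InvertibleAutomaton

/-! ### Affine automorphisms -/

/-- The transformation `x ↦ b + x · A` of the space of infinite row vectors over `ℤ/d`, for an upper
triangular infinite matrix `A`: the entries `A i j` with `j < i` vanish, so that the `j`-th
coordinate of `x · A` is the sum of the `x i * A i j` over `i ≤ j`. -/
def affineMap {d : ℕ} (A : Matrix ℕ ℕ (ZMod d)) (b x : ℕ → ZMod d) : ℕ → ZMod d :=
  fun j => b j + ∑ i ∈ Finset.range (j + 1), x i * A i j

/-- The prefix of length `n` of an infinite word, i.e. the `n`-th vertex of the corresponding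
infinite path in the tree. -/
def wordPrefix {X : Type*} (x : ℕ → X) (n : ℕ) : List X := List.ofFn fun i : Fin n => x i

/-- A tree automorphism is affine if the transformation that it induces on the boundary of the tree
is `x ↦ b + x · A` for some upper triangular matrix `A` with units on the diagonal and some
vector `b`. -/
def IsAffine {d : ℕ} (g : TreeAut (ZMod d)) : Prop :=
  ∃ (A : Matrix ℕ ℕ (ZMod d)) (b : ℕ → ZMod d),
    (∀ i j, j < i → A i j = 0) ∧ (∀ i, IsUnit (A i i)) ∧
    ∀ (x : ℕ → ZMod d) (n : ℕ), g.app (wordPrefix x n) = wordPrefix (affineMap A b x) n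

/-! ### Restricted wreath products and the lamplighter group of rank 2 -/

/-- The restricted regular wreath product of `D` by `Q`: the elements of the unrestricted one whose
base component has finite support. -/
def restrictedWreathProduct (D Q : Type*) [Group D] [Group Q] : Subgroup (D ≀ᵣ Q) where
  carrier := {w | (Function.mulSupport w.left).Finite}
  one_mem' := by simp
  mul_mem' := by
    intro v w hv hw
    have hw' : (Function.mulSupport fun q : Q => w.left (v.right⁻¹ * q)).Finite :=
      Set.Finite.preimage ((mul_right_injective v.right⁻¹).injOn) hw
    refine (Set.Finite.union hv hw').subset ?_
    exact Function.mulSupport_mul _ _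
  inv_mem' := by
    intro w hw
    have hw' : (Function.mulSupport fun q : Q => w.left (w.right * q)).Finite :=
      Set.Finite.preimage ((mul_right_injective w.right).injOn) hw
    refine hw'.subset fun q hq => ?_
    simpa using hq

namespace restrictedWreathProduct

variable {D Q : Type*} [Group D] [Group Q]

/-- The copy of the element `h` of `D` in the factor of the base group with index `1`. -/
def lamp [DecidableEq Q] (h : D) : restrictedWreathProduct D Q :=
  ⟨⟨Pi.mulSingle 1 h, 1⟩, (Set.finite_singleton (1 : Q)).subset Pi.mulSupport_mulSingle_subset⟩

/-- The copy of the element `q` of `Q`. -/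
def shift (q : Q) : restrictedWreathProduct D Q :=
  ⟨RegularWreathProduct.inl q, by simp [restrictedWreathProduct]⟩

end restrictedWreathProduct

/-- The lamplighter group of rank 2, i.e. the restricted wreath product of `(ℤ/2)²` by `ℤ`. -/
abbrev Lamplighter2 : Type :=
  restrictedWreathProduct (Multiplicative (ZMod 2 × ZMod 2)) (Multiplicative ℤ)

namespace Lamplighter2

/-- The first standard generator of `(ℤ/2)²`. -/
def X : Lamplighter2 := restrictedWreathProduct.lamp (Multiplicative.ofAdd (1, 0))

/-- The second standard generator of `(ℤ/2)²`. -/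
def Y : Lamplighter2 := restrictedWreathProduct.lamp (Multiplicative.ofAdd (0, 1))

/-- The standard generator of `ℤ`. -/
def T : Lamplighter2 := restrictedWreathProduct.shift (Multiplicative.ofAdd 1)

end Lamplighter2

/-! ### The automaton with four states -/

/-- The four states of the automaton. -/
inductive FourStates
  | a | b | c | d

/-- The automaton `a = (d,d)σ`, `b = (c,c)`, `c = (a,b)`, `d = (b,a)` over the alphabet `{0,1}`. -/
def fourStateAutomaton : InvertibleAutomaton FourStates (ZMod 2) where
  next
    | .a, _ => .d
    | .b, _ => .c
    | .c, i => if i = 0 then .a else .b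
    | .d, i => if i = 0 then .b else .a
  out
    | .a => Equiv.swap 0 1
    | .b => 1
    | .c => 1
    | .d => 1

namespace GroupG

/-- The automorphism `a` of the binary tree. -/
def a : TreeAut (ZMod 2) := fourStateAutomaton.aut .a

/-- The automorphism `b` of the binary tree. -/
def b : TreeAut (ZMod 2) := fourStateAutomaton.aut .b

/-- The automorphism `c` of the binary tree. -/
def c : TreeAut (ZMod 2) := fourStateAutomaton.aut .c

/-- The automorphism `d` of the binary tree. -/
def d : TreeAut (ZMod 2) := fourStateAutomaton.aut .d

/-- The element `x = ab`. -/
def x : TreeAut (ZMod 2) := a * b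

/-- The element `y = cd`. -/
def y : TreeAut (ZMod 2) := c * d

/-- The element `t = ac`. -/
def t : TreeAut (ZMod 2) := a * c

/-- The group generated by `a, b, c, d`. -/
def G : Subgroup (TreeAut (ZMod 2)) := fourStateAutomaton.group

/-- The subgroup generated by `x, y, t`. -/
def L : Subgroup (TreeAut (ZMod 2)) := Subgroup.closure {x, y, t}

end GroupG

/-! Encode a binary sequence by the power series of its even and of its odd terms. Every state is an
affine involution of the boundary: `a`, `b` share one linear part, `c`, `d` share another
(`run_addTo`), and `b`, `d` differ from `a`, `c` by translations (`run_b_and_run_d`). So `x` and `y`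
are translations, and conjugation by `t` acts on translations through a product of two elementary
matrices with entries polynomial in `geom`.

The heart of the matter is that the conjugates of `x` and `y` by powers of `t` are independent. As
`geom` is transcendental, these conjugates are the images of the two basis vectors of `(ZMod 2)[X]²`
under powers of `rho`. Instead of computing them, `toLamps` uses a polynomial-module structure on
lamp configurations in which `rho` becomes the shift. It is a left inverse of `lampSum` on finite
configurations (`toLamps_lampSum`), which gives faithfulness on the base group; a commutator with
`X` extends this to the whole lamplighter group (`treeAction_injective`).

Conjugation by `a` inverts `t`, which no element of `L` can do; this yields the semidirect product
and the index. Having a linear part is inherited by products, and compatibility with prefixes forces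
its matrix to be triangular. -/

/-! ### Translations of the binary tree by pairs of power series -/

/-- Sequences over `ℤ/2`, encoded by the power series of their terms with even index and with odd
index. -/
abbrev SeqPair : Type := PowerSeries (ZMod 2) × PowerSeries (ZMod 2)

namespace SeqPair

/-- The first term of the sequence. -/
noncomputable def head (e : SeqPair) : ZMod 2 := PowerSeries.constantCoeff e.1

/-- The sequence without its first term. -/
noncomputable def tail (e : SeqPair) : SeqPair :=
  (e.2, PowerSeries.mk fun n => PowerSeries.coeff (n + 1) e.1)

theorem head_add (e f : SeqPair) : (e + f).head = e.head + f.head := by simp [head]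

theorem tail_add (e f : SeqPair) : (e + f).tail = e.tail + f.tail := by
  ext <;> simp [tail]

theorem head_zero : (0 : SeqPair).head = 0 := by simp [head]

theorem add_self (e : SeqPair) : e + e = 0 := ZModModule.add_self e

theorem tail_zero : (0 : SeqPair).tail = 0 := by
  ext <;> simp [tail]

/-- The automaton whose state `e` adds the sequence `e` to the input. -/
noncomputable def automaton : InvertibleAutomaton SeqPair (ZMod 2) where
  next e _ := e.tail
  out e := Equiv.addRight e.head

/-- Addition of the sequence `e` to a word. -/
noncomputable abbrev addTo (e : SeqPair) (v : List (ZMod 2)) : List (ZMod 2) := automaton.run e v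

theorem addTo_cons (e : SeqPair) (i : ZMod 2) (v : List (ZMod 2)) :
    e.addTo (i :: v) = (i + e.head) :: e.tail.addTo v := rfl

theorem addTo_zero (v : List (ZMod 2)) : addTo 0 v = v := by
  induction v with
  | nil => rfl
  | cons i v ih => rw [addTo_cons, tail_zero, ih, head_zero, add_zero]

theorem addTo_add (e f : SeqPair) (v : List (ZMod 2)) :
    (e + f).addTo v = f.addTo (e.addTo v) := by
  induction v generalizing e f with
  | nil => rfl
  | cons i v ih => simp only [addTo_cons, tail_add, head_add, ih, add_assoc]

end SeqPair

theorem TreeAut.ext_app {X : Type*} {g h : TreeAut X} (H : ∀ v, g.app v = h.app v) : g = h :=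
  MulOpposite.unop_injective (RelIso.ext H)

namespace GroupG

open SeqPair

/-- The translation of the binary tree by a sequence. -/
noncomputable def translation : Multiplicative SeqPair →* TreeAut (ZMod 2) where
  toFun e := automaton.aut e.toAdd
  map_one' := TreeAut.ext_app addTo_zero
  map_mul' e f := TreeAut.ext_app (addTo_add e.toAdd f.toAdd)

/-- The power series `1 / (1 + z)`. -/
def geom : PowerSeries (ZMod 2) := PowerSeries.mk fun _ => 1

theorem one_add_geom : 1 + geom = PowerSeries.X * geom := by
  ext n
  cases n with
  | zero => simp [geom]; rfl
  | succ n => simp [geom, PowerSeries.coeff_one, PowerSeries.coeff_succ_X_mul]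

theorem geom_mul_one_add_X : geom * (1 + PowerSeries.X) = 1 := by
  have h := one_add_geom
  have h2 : geom + geom = 0 := ZModModule.add_self geom
  linear_combination -h + h2

/-- The sequence by which `x` translates. -/
def seqX : SeqPair := (geom, 0)

/-- The sequence by which `y` translates. -/
def seqY : SeqPair := (0, geom)

theorem tail_seqX : seqX.tail = seqY := by
  ext <;> simp [seqX, seqY, tail, geom]

theorem tail_seqY : seqY.tail = seqX := by
  ext <;> simp [seqX, seqY, tail]

theorem head_seqX : seqX.head = 1 := by simp [seqX, head, geom]

theorem head_seqY : seqY.head = 0 := by simp [seqY, head]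

/-! ### The four states as affine maps. -/

/-- The linear part of the affine maps `a` and `b`. -/
noncomputable def linearA : SeqPair →ₗ[ZMod 2] SeqPair where
  toFun e := (e.1 + (1 + geom) * e.2, e.2)
  map_add' e f := by ext1 <;> simp only [Prod.fst_add, Prod.snd_add]; ring
  map_smul' r e := by ext1 <;> simp [smul_add]

/-- The linear part of the affine maps `c` and `d`. -/
noncomputable def linearC : SeqPair →ₗ[ZMod 2] SeqPair where
  toFun e := (e.1, e.2 + geom * e.1)
  map_add' e f := by ext1 <;> simp only [Prod.fst_add, Prod.snd_add]; ring
  map_smul' r e := by ext1 <;> simp [smul_add]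

/-- The linear part of the affine map given by a state of the automaton. -/
noncomputable def linearPart : FourStates → SeqPair →ₗ[ZMod 2] SeqPair
  | .a => linearA
  | .b => linearA
  | .c => linearC
  | .d => linearC

theorem head_linearA (e : SeqPair) : (linearA e).head = e.head := by
  simp [linearA, head, one_add_geom]

theorem head_linearC (e : SeqPair) : (linearC e).head = e.head := rfl

/-- Taking the tail swaps the two series and divides the even one by the variable; since `1 + geom`
is the variable times `geom`, the coefficient left over is `geom`. -/
theorem tail_linearA (e : SeqPair) : (linearA e).tail = linearC e.tail := by
  ext n
  · rfl
  · simp [linearA, linearC, tail, one_add_geom, mul_assoc, PowerSeries.coeff_succ_X_mul]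

/-- The correction term accounts for the first letter being flipped, which exchanges the next states
`a` and `b`; these differ by `seqX`. -/
theorem tail_linearC (e : SeqPair) : (linearC e).tail = linearA e.tail + e.head • seqX := by
  ext1
  · have h := PowerSeries.eq_X_mul_shift_add_const e.1
    simp only [linearA, linearC, tail, one_add_geom, head, seqX, LinearMap.coe_mk, AddHom.coe_mk,
      Prod.fst_add, Prod.smul_fst, PowerSeries.smul_eq_C_mul]
    linear_combination geom * h
  · simp [linearA, linearC, tail, seqX]

theorem run_a_cons (i : ZMod 2) (v : List (ZMod 2)) : fourStateAutomaton.run .a (i :: v) =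
    (i + 1) :: fourStateAutomaton.run .d v := by
  have h : ∀ j : ZMod 2, Equiv.swap 0 1 j = j + 1 := by decide
  rw [← h]
  rfl

theorem run_b_cons (i : ZMod 2) (v : List (ZMod 2)) : fourStateAutomaton.run .b (i :: v) =
    i :: fourStateAutomaton.run .c v := rfl

theorem run_c_cons (i : ZMod 2) (v : List (ZMod 2)) : fourStateAutomaton.run .c (i :: v) =
    i :: fourStateAutomaton.run (if i = 0 then .a else .b) v := rfl

theorem run_d_cons (i : ZMod 2) (v : List (ZMod 2)) : fourStateAutomaton.run .d (i :: v) =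
    i :: fourStateAutomaton.run (if i = 0 then .b else .a) v := rfl

theorem addTo_addTo_self (e : SeqPair) (v : List (ZMod 2)) : e.addTo (e.addTo v) = v := by
  rw [← addTo_add, SeqPair.add_self, addTo_zero]

/-- The two comparisons feed each other in the induction, because `seqX` and `seqY` are each other's
tails. -/
theorem run_b_and_run_d (v : List (ZMod 2)) :
    fourStateAutomaton.run .b v = seqX.addTo (fourStateAutomaton.run .a v) ∧
    fourStateAutomaton.run .d v = seqY.addTo (fourStateAutomaton.run .c v) := by
  induction v with
  | nil => exact ⟨rfl, rfl⟩
  | cons i v ih =>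
    constructor
    · rw [run_b_cons, run_a_cons, addTo_cons, tail_seqX, head_seqX, ih.2, addTo_addTo_self,
        add_assoc, ZModModule.add_self, add_zero]
    · rw [run_d_cons, run_c_cons, addTo_cons, tail_seqY, head_seqY, add_zero]
      split_ifs
      · rw [ih.1]
      · rw [ih.1, addTo_addTo_self]

/-- For `a` and `b` the next state ignores the letter, so the tail formula suffices. For `c` and `d`
the cases on `e.head` and on the letter match the switch of next state with the extra `seqX`. -/
theorem run_addTo (q : FourStates) (e : SeqPair) (v : List (ZMod 2)) :
    fourStateAutomaton.run q (e.addTo v) =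
      (linearPart q e).addTo (fourStateAutomaton.run q v) := by
  induction v generalizing q e with
  | nil => rfl
  | cons i v ih =>
    have hb := (run_b_and_run_d v).1
    have hcomm (f : SeqPair) (w : List (ZMod 2)) :
        f.addTo (seqX.addTo w) = seqX.addTo (f.addTo w) := by
      rw [← addTo_add, add_comm, addTo_add]
    have h01 : ∀ j : ZMod 2, j = 0 ∨ j = 1 := by decide
    have h11 : (1 : ZMod 2) + 1 = 0 := rfl
    cases q with
    | a =>
      simp only [run_a_cons, addTo_cons, linearPart, head_linearA, tail_linearA, ih]
      rw [add_right_comm]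
    | b => simp only [run_b_cons, addTo_cons, linearPart, head_linearA, tail_linearA, ih]
    | c =>
      simp only [run_c_cons, addTo_cons, linearPart, head_linearC, tail_linearC, ih, addTo_add]
      rcases h01 e.head with h | h <;> rcases h01 i with rfl | rfl <;>
        simp [h, h11, hb, hcomm, addTo_zero, addTo_addTo_self]
    | d =>
      simp only [run_d_cons, addTo_cons, linearPart, head_linearC, tail_linearC, ih, addTo_add]
      rcases h01 e.head with h | h <;> rcases h01 i with rfl | rfl <;>
        simp [h, h11, hb, hcomm, addTo_zero, addTo_addTo_self]

theorem run_run (q : FourStates) (v : List (ZMod 2)) :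
    fourStateAutomaton.run q (fourStateAutomaton.run q v) = v := by
  induction v generalizing q with
  | nil => rfl
  | cons i v ih =>
    cases q
    · rw [run_a_cons, run_a_cons, ih, add_assoc, ZModModule.add_self, add_zero]
    all_goals simp only [run_b_cons, run_c_cons, run_d_cons, ih]

theorem aut_mul_self (q : FourStates) :
    fourStateAutomaton.aut q * fourStateAutomaton.aut q = 1 :=
  TreeAut.ext_app (run_run q)

theorem translation_mul_aut (q : FourStates) (e : SeqPair) :
    translation (.ofAdd e) * fourStateAutomaton.aut q =
      fourStateAutomaton.aut q * translation (.ofAdd (linearPart q e)) :=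
  TreeAut.ext_app (run_addTo q e)

/-! ### Conjugation relations. -/

theorem a_mul_a : a * a = 1 := aut_mul_self .a

theorem c_mul_c : c * c = 1 := aut_mul_self .c

theorem b_eq : b = a * translation (.ofAdd seqX) :=
  TreeAut.ext_app fun v => (run_b_and_run_d v).1

theorem d_eq : d = c * translation (.ofAdd seqY) :=
  TreeAut.ext_app fun v => (run_b_and_run_d v).2

theorem x_eq : x = translation (.ofAdd seqX) := by
  rw [x, b_eq, ← mul_assoc, a_mul_a, one_mul]

theorem y_eq : y = translation (.ofAdd seqY) := by
  rw [y, d_eq, ← mul_assoc, c_mul_c, one_mul]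

theorem a_inv : a⁻¹ = a := inv_eq_of_mul_eq_one_left a_mul_a

theorem c_inv : c⁻¹ = c := inv_eq_of_mul_eq_one_left c_mul_c

theorem t_inv : t⁻¹ = c * a := by rw [t, mul_inv_rev, a_inv, c_inv]

theorem a_mul_translation_mul_a (e : SeqPair) :
    a * translation (.ofAdd e) * a = translation (.ofAdd (linearA e)) := by
  rw [mul_assoc]
  change a * (_ * fourStateAutomaton.aut .a) = _
  rw [translation_mul_aut, ← mul_assoc]
  exact (congrArg (· * _) a_mul_a).trans (one_mul _)

theorem c_mul_translation_mul_c (e : SeqPair) :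
    c * translation (.ofAdd e) * c = translation (.ofAdd (linearC e)) := by
  rw [mul_assoc]
  change c * (_ * fourStateAutomaton.aut .c) = _
  rw [translation_mul_aut, ← mul_assoc]
  exact (congrArg (· * _) c_mul_c).trans (one_mul _)

theorem t_conj_translation (e : SeqPair) :
    t * translation (.ofAdd e) * t⁻¹ = translation (.ofAdd (linearA (linearC e))) := by
  rw [← a_mul_translation_mul_a, ← c_mul_translation_mul_c, t_inv, t]
  simp only [mul_assoc]

theorem linearA_seqX : linearA seqX = seqX := by
  simp [linearA, seqX]

theorem linearC_seqY : linearC seqY = seqY := by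
  simp [linearC, seqY]

theorem a_conj_x : a⁻¹ * x * a = x := by
  rw [a_inv, x_eq, a_mul_translation_mul_a, linearA_seqX]

/-- The factor `c` of `t` centralizes `y`, so only the conjugation by `a` remains. -/
theorem a_conj_y : a⁻¹ * y * a = t * y * t⁻¹ := by
  rw [a_inv, y_eq, t_conj_translation, a_mul_translation_mul_a, linearC_seqY]

theorem a_conj_t : a⁻¹ * t * a = t⁻¹ := by
  rw [a_inv, t_inv, t, ← mul_assoc a, a_mul_a, one_mul]

/-! ### Translations by pairs of polynomials and their lamp coordinates -/

open Polynomial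

/-- The coordinates of a translation in `⟨x, y⟩ ≀ ⟨t⟩`: pairs of polynomials in `1 / (1 + z)`. -/
abbrev PolyPair : Type := (ZMod 2)[X] × (ZMod 2)[X]

theorem aeval_powerSeries_X {R : Type*} [CommSemiring R] (p : R[X]) :
    aeval (PowerSeries.X : PowerSeries R) p = p := by
  induction p using Polynomial.induction_on' with
  | add p q hp hq => simp [hp, hq]
  | monomial n r =>
    rw [aeval_monomial, ← C_mul_X_pow_eq_monomial, coe_mul, coe_pow, coe_X, coe_C]
    rfl

/-- Algebraicity would pass to the inverse `1 + z` and then to the variable `z`, yet polynomials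
embed in power series. -/
theorem transcendental_geom : Transcendental (ZMod 2) geom := by
  intro h
  let _ : Invertible geom := ⟨1 + PowerSeries.X, (mul_comm _ _).trans geom_mul_one_add_X,
    geom_mul_one_add_X⟩
  have h1 : IsAlgebraic (ZMod 2) (1 + PowerSeries.X : PowerSeries (ZMod 2)) := h.invOf
  obtain ⟨p, hp, hp0⟩ : IsAlgebraic (ZMod 2) (PowerSeries.X : PowerSeries (ZMod 2)) := by
    simpa using h1.sub isAlgebraic_one
  rw [aeval_powerSeries_X] at hp0
  exact hp (Polynomial.coe_injective _ (hp0.trans Polynomial.coe_zero.symm))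

/-- The sequence encoded by a pair of polynomials. -/
noncomputable def toSeqPair : PolyPair →+ SeqPair where
  -- The common factor `geom` makes the basis vectors correspond to `seqX` and `seqY`.
  toFun v := (geom * aeval geom v.1, geom * aeval geom v.2)
  map_zero' := by simp
  map_add' v w := by simp [mul_add]

theorem toSeqPair_injective : Function.Injective toSeqPair := by
  have hinj := transcendental_iff_injective.mp transcendental_geom
  have h0 : geom ≠ 0 := left_ne_zero_of_mul_eq_one geom_mul_one_add_X
  intro v w h
  obtain ⟨h1, h2⟩ := Prod.ext_iff.mp h
  exact Prod.ext (hinj (mul_left_cancel₀ h0 h1)) (hinj (mul_left_cancel₀ h0 h2))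

/-- Conjugation by `t⁻¹` on the translations. -/
noncomputable def rho : PolyPair ≃ₗ[ZMod 2] PolyPair where
  -- This is `linearA ∘ linearC` with `X` in place of `geom`. Elementary matrices have polynomial
  -- inverses, so negative powers of `t` also preserve polynomial pairs.
  toFun v := (v.1 + (1 + X) * (v.2 + X * v.1), v.2 + X * v.1)
  invFun v := (v.1 - (1 + X) * v.2, v.2 - X * (v.1 - (1 + X) * v.2))
  left_inv v := by ext1 <;> simp only <;> ring
  right_inv v := by ext1 <;> simp only <;> ring
  map_add' v w := by ext1 <;> simp only [Prod.fst_add, Prod.snd_add] <;> ring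
  map_smul' r v := by
    ext1 <;> simp only [Prod.smul_fst, Prod.smul_snd, smul_eq_C_mul, RingHom.id_apply] <;> ring

theorem toSeqPair_rho (v : PolyPair) : toSeqPair (rho v) = linearA (linearC (toSeqPair v)) := by
  ext1 <;> simp [toSeqPair, rho, linearA, linearC] <;> ring

/-- The translation of the tree encoded by a pair of polynomials. -/
noncomputable def polyTranslation : Multiplicative PolyPair →* TreeAut (ZMod 2) :=
  translation.comp toSeqPair.toMultiplicative

/-- A trivial translation has zero head and trivial tail; two tails shift the even series by one
coefficient. -/
theorem coeff_eq_zero_of_addTo_eq_self (n : ℕ) (e : SeqPair) (h : ∀ v, e.addTo v = v) :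
    PowerSeries.coeff n e.1 = 0 := by
  have key (f : SeqPair) (hf : ∀ v, f.addTo v = v) : f.head = 0 ∧ ∀ v, f.tail.addTo v = v := by
    have h' (v : List (ZMod 2)) := List.cons_eq_cons.mp (hf (0 :: v))
    exact ⟨(zero_add _).symm.trans (h' []).1, fun v => (h' v).2⟩
  induction n generalizing e with
  | zero => exact (PowerSeries.coeff_zero_eq_constantCoeff_apply _).trans (key e h).1
  | succ n ih =>
    rw [← ih e.tail.tail (key _ (key e h).2).2]
    simp [tail]

theorem translation_injective : Function.Injective translation := by
  refine (injective_iff_map_eq_one _).mpr fun e he => ?_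
  have h (v : List (ZMod 2)) : addTo e.toAdd v = v := congrArg (fun g => TreeAut.app g v) he
  have h' (v : List (ZMod 2)) : addTo (tail e.toAdd) v = v :=
    (List.cons_eq_cons.mp (h (0 :: v))).2
  refine Multiplicative.toAdd.injective (Prod.ext ?_ ?_) <;> ext n
  · exact coeff_eq_zero_of_addTo_eq_self n _ h
  · exact coeff_eq_zero_of_addTo_eq_self n _ h'

theorem polyTranslation_injective : Function.Injective polyTranslation :=
  translation_injective.comp toSeqPair_injective

theorem t_conj_polyTranslation (v : PolyPair) :
    t * polyTranslation (.ofAdd v) * t⁻¹ = polyTranslation (.ofAdd (rho v)) :=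
  (t_conj_translation _).trans (congrArg (fun e => translation (.ofAdd e)) (toSeqPair_rho v).symm)

theorem t_inv_conj_polyTranslation (v : PolyPair) :
    t⁻¹ * polyTranslation (.ofAdd v) * t = polyTranslation (.ofAdd (rho⁻¹ v)) := by
  have h := t_conj_polyTranslation (rho⁻¹ v)
  rw [← LinearEquiv.mul_apply, mul_inv_cancel] at h
  change _ = polyTranslation (.ofAdd v) at h
  rw [← h]
  group

theorem t_zpow_conj_polyTranslation (n : ℤ) (v : PolyPair) :
    t ^ n * polyTranslation (.ofAdd v) * (t ^ n)⁻¹ = polyTranslation (.ofAdd ((rho ^ n) v)) := by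
  induction n generalizing v with
  | zero => simp
  | succ n ih =>
    rw [zpow_add_one, zpow_add_one, LinearEquiv.mul_apply, ← ih, ← t_conj_polyTranslation]
    group
  | pred n ih =>
    rw [zpow_sub_one, zpow_sub_one, LinearEquiv.mul_apply, ← ih, ← t_inv_conj_polyTranslation]
    group

/-! ### Lamp configurations as a module over polynomials. -/

/-- The configurations of lamps, without a finiteness condition. -/
abbrev Lamps : Type := ℤ → ZMod 2 × ZMod 2

/-- Multiplication by the polynomial variable, in the lamp coordinates. -/
def mulX : Lamps →ₗ[ZMod 2] Lamps where
  -- The formula is forced. With `S` the shift and `e₁`, `e₂` the lamps at `0`, the second column of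
  -- `rho` requires `S e₂ = (1 + X) e₁ + e₂`, so `X e₁ = e₁ + e₂ + S e₂`; the first column then
  -- gives `X e₂ = e₁ + S⁻¹ e₁`.
  toFun f k := ((f k).1 + (f k).2 + (f (k + 1)).2, (f k).1 + (f (k - 1)).1)
  map_add' f g := by ext k <;> simp <;> ring
  map_smul' r f := by ext k <;> simp [mul_add]

/-- The shift of the lamp coordinates. -/
def shiftLamps : Lamps →ₗ[ZMod 2] Lamps where
  toFun f k := f (k - 1)
  map_add' _ _ := rfl
  map_smul' _ _ := rfl

theorem aeval_mulX_shiftLamps (p : (ZMod 2)[X]) (f : Lamps) :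
    aeval mulX p (shiftLamps f) = shiftLamps (aeval mulX p f) := by
  have h : Commute shiftLamps mulX := by
    refine LinearMap.ext fun g => funext fun k => ?_
    have h1 : k - 1 + 1 = k + 1 - 1 := by ring
    simp [shiftLamps, mulX, h1]
  have h2 := Algebra.commute_of_mem_adjoin_singleton_of_commute
    (aeval_mem_adjoin_singleton (ZMod 2) mulX (p := p)) h
  exact (LinearMap.congr_fun h2 f).symm

theorem mulX_identity_fst (δ : ℤ → ZMod 2) :
    (fun k => (δ k, 0)) + (1 + mulX) (mulX fun k => (δ k, 0)) + mulX (fun k => (0, δ k)) =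
      shiftLamps fun k => (δ k, 0) := by
  have h : ∀ p q r : ZMod 2, p + (p + (p + (p + q) + (r + p))) + (p + r) = q ∧
      p + q + (p + q) = 0 := by decide
  funext k
  simpa [mulX, shiftLamps] using h (δ k) (δ (k - 1)) (δ (k + 1))

theorem mulX_identity_snd (δ : ℤ → ZMod 2) :
    (1 + mulX) (fun k => (δ k, 0)) + (fun k => (0, δ k)) = shiftLamps fun k => (0, δ k) := by
  have h : ∀ p q : ZMod 2, p + p = 0 ∧ p + q + p = q := by decide
  funext k
  simpa [mulX, shiftLamps] using h (δ k) (δ (k - 1))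

/-- The configuration that vanishes outside the index `0`. -/
def lampAtZero (d : ZMod 2 × ZMod 2) : Lamps := fun k => if k = 0 then d else 0

/-- The lamp coordinates of a pair of polynomials. -/
noncomputable def toLamps : PolyPair →+ Lamps where
  toFun v := aeval mulX v.1 (lampAtZero (1, 0)) + aeval mulX v.2 (lampAtZero (0, 1))
  map_zero' := by simp
  map_add' v w := by simp; abel

/-- Since `mulX` commutes with the shift, it is enough to compare the two sides on the basis
vectors, which is what `mulX_identity_fst` and `mulX_identity_snd` do. -/
theorem toLamps_rho (v : PolyPair) : toLamps (rho v) = shiftLamps (toLamps v) := by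
  have e1 : lampAtZero (1, 0) = fun k => (if k = 0 then 1 else 0, 0) := by
    funext k; unfold lampAtZero; split_ifs <;> rfl
  have e2 : lampAtZero (0, 1) = fun k => (0, if k = 0 then 1 else 0) := by
    funext k; unfold lampAtZero; split_ifs <;> rfl
  have h1 := mulX_identity_fst fun k => if k = 0 then 1 else 0
  have h2 := mulX_identity_snd fun k => if k = 0 then 1 else 0
  rw [← e1, ← e2] at h1 h2
  have hp : (rho v).1 = v.1 * (1 + (1 + X) * X) + v.2 * (1 + X) := by
    simp only [rho, LinearEquiv.coe_mk, LinearMap.coe_mk, AddHom.coe_mk]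
    ring
  have hq : (rho v).2 = v.2 + v.1 * X := by
    simp only [rho, LinearEquiv.coe_mk, LinearMap.coe_mk, AddHom.coe_mk]
    ring
  change aeval mulX (rho v).1 _ + aeval mulX (rho v).2 _ =
    shiftLamps (aeval mulX v.1 _ + aeval mulX v.2 _)
  rw [map_add, ← aeval_mulX_shiftLamps, ← aeval_mulX_shiftLamps, ← h1, ← h2, hp, hq]
  simp only [map_add, map_mul, map_one, aeval_X, LinearMap.add_apply, Module.End.mul_apply,
    Module.End.one_apply]
  abel

theorem toLamps_rho_zpow (n : ℤ) (v : PolyPair) (k : ℤ) :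
    toLamps ((rho ^ n) v) k = toLamps v (k - n) := by
  induction n generalizing v k with
  | zero => simp
  | succ n ih =>
    rw [zpow_add_one, LinearEquiv.mul_apply, ih, toLamps_rho]
    exact congrArg (toLamps v) (by ring)
  | pred n ih =>
    have h (w : PolyPair) (j : ℤ) : toLamps (rho⁻¹ w) j = toLamps w (j + 1) := by
      have h1 : w = rho (rho⁻¹ w) := by rw [← LinearEquiv.mul_apply, mul_inv_cancel]; rfl
      conv_rhs => rw [h1, toLamps_rho]
      exact congrArg (toLamps (rho⁻¹ w)) (by ring)
    rw [zpow_sub_one, LinearEquiv.mul_apply, ih, h]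
    exact congrArg (toLamps v) (by ring)

/-- The pair of constant polynomials that encodes a lamp with index `0`. -/
noncomputable def constPair : ZMod 2 × ZMod 2 →+ PolyPair where
  toFun d := (C d.1, C d.2)
  map_zero' := by simp
  map_add' d e := by simp

theorem toLamps_constPair (d : ZMod 2 × ZMod 2) : toLamps (constPair d) = lampAtZero d := by
  have h : toLamps (constPair d) = d.1 • lampAtZero (1, 0) + d.2 • lampAtZero (0, 1) := by
    simp [toLamps, constPair, Module.algebraMap_end_apply]
  rw [h]
  funext k
  by_cases hk : k = 0 <;> simp [lampAtZero, hk]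

/-- The sum of the lamps of a configuration. -/
noncomputable def lampSum (f : Lamps) : PolyPair := ∑ᶠ k, (rho ^ k) (constPair (f k))

theorem support_lampSum {f : Lamps} (hf : (Function.support f).Finite) :
    (Function.support fun k => (rho ^ k) (constPair (f k))).Finite :=
  hf.subset fun k hk h0 => hk (by simp [h0])

/-- The `k`-th summand becomes a lamp at index `k` alone, so only `k = j` contributes at index `j`.
-/
theorem toLamps_lampSum {f : Lamps} (hf : (Function.support f).Finite) :
    toLamps (lampSum f) = f := by
  funext j
  have h := AddMonoidHom.map_finsum ((Pi.evalAddMonoidHom _ j).comp toLamps) (support_lampSum hf)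
  refine h.trans ?_
  rw [finsum_eq_single _ j]
  · simp [toLamps_rho_zpow, toLamps_constPair, lampAtZero]
  · intro k hk
    simp [toLamps_rho_zpow, toLamps_constPair, lampAtZero, sub_eq_zero, hk.symm]

theorem lampSum_add {f g : Lamps} (hf : (Function.support f).Finite)
    (hg : (Function.support g).Finite) : lampSum (f + g) = lampSum f + lampSum g := by
  unfold lampSum
  rw [← finsum_add_distrib (support_lampSum hf) (support_lampSum hg)]
  simp

theorem lampSum_shift {f : Lamps} (hf : (Function.support f).Finite) (n : ℤ) :
    lampSum (fun k => f (-n + k)) = (rho ^ n) (lampSum f) := by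
  unfold lampSum
  have h := AddMonoidHom.map_finsum (rho ^ n).toAddEquiv.toAddMonoidHom (support_lampSum hf)
  refine Eq.trans ?_ h.symm
  rw [← finsum_comp_equiv (Equiv.addLeft n)]
  refine finsum_congr fun k => ?_
  simp [zpow_add]

theorem lampSum_lampAtZero (d : ZMod 2 × ZMod 2) : lampSum (lampAtZero d) = constPair d := by
  unfold lampSum
  rw [finsum_eq_single _ 0]
  · simp [lampAtZero]
  · intro k hk
    simp [lampAtZero, hk]

/-! ### The lamplighter group and its action on the tree -/

/-- The configuration of lamps of an element of the lamplighter group. -/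
def lamps (w : Lamplighter2) : Lamps := fun k => (w.1.left (.ofAdd k)).toAdd

/-- The position of the lamplighter. -/
def position : Lamplighter2 →* Multiplicative ℤ :=
  RegularWreathProduct.rightHom.comp (Subgroup.subtype _)

theorem support_lamps (w : Lamplighter2) : (Function.support (lamps w)).Finite := by
  have h : (Function.mulSupport w.1.left).Finite := w.2
  exact h.preimage Multiplicative.ofAdd.injective.injOn

theorem lamps_mul (v w : Lamplighter2) :
    lamps (v * w) = lamps v + fun k => lamps w (-(position v).toAdd + k) := rfl

theorem lamps_ext {v w : Lamplighter2} (h : lamps v = lamps w) (hp : position v = position w) :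
    v = w :=
  Subtype.ext (RegularWreathProduct.ext h hp)

/-- The action of the lamplighter group on the binary tree. -/
noncomputable def treeAction : Lamplighter2 →* TreeAut (ZMod 2) where
  toFun w := polyTranslation (.ofAdd (lampSum (lamps w))) * t ^ (position w).toAdd
  map_one' := by
    have h : lampSum (lamps 1) = 0 := by
      have h1 : lamps 1 = lampAtZero 0 := by funext k; simp [lampAtZero]; rfl
      rw [h1, lampSum_lampAtZero, map_zero]
    rw [h]
    simp
  map_mul' v w := by
    have hs : (Function.support fun k => lamps w (-(position v).toAdd + k)).Finite :=
      (support_lamps w).preimage (add_right_injective _).injOn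
    -- Moving the lamps of `w` by the position `n` of `v` applies `rho ^ n`, which is conjugation by
    -- `t ^ n`.
    rw [lamps_mul, lampSum_add (support_lamps v) hs, lampSum_shift (support_lamps w), ofAdd_add,
      map_mul, ← t_zpow_conj_polyTranslation, map_mul, toAdd_mul, zpow_add]
    group

theorem treeAction_apply (w : Lamplighter2) : treeAction w =
    polyTranslation (.ofAdd (lampSum (lamps w))) * t ^ (position w).toAdd := rfl

theorem treeAction_lamp (d : ZMod 2 × ZMod 2) :
    treeAction (restrictedWreathProduct.lamp (.ofAdd d)) =
      polyTranslation (.ofAdd (constPair d)) := by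
  have h : lamps (restrictedWreathProduct.lamp (.ofAdd d)) = lampAtZero d := by
    funext k
    by_cases hk : k = 0
    · subst hk; rfl
    · have hk' : Multiplicative.ofAdd k ≠ 1 := hk
      simp [lamps, restrictedWreathProduct.lamp, lampAtZero, hk, hk']
  rw [treeAction_apply, h, lampSum_lampAtZero]
  exact mul_one _

theorem treeAction_X : treeAction Lamplighter2.X = x := by
  refine (treeAction_lamp _).trans ?_
  rw [x_eq]
  simp [polyTranslation, toSeqPair, constPair, seqX]

theorem treeAction_Y : treeAction Lamplighter2.Y = y := by
  refine (treeAction_lamp _).trans ?_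
  rw [y_eq]
  simp [polyTranslation, toSeqPair, constPair, seqY]

theorem treeAction_T : treeAction Lamplighter2.T = t := by
  have h : lamps Lamplighter2.T = lampAtZero 0 := by funext k; simp [lampAtZero]; rfl
  rw [treeAction_apply, h, lampSum_lampAtZero, map_zero, ofAdd_zero, map_one]
  exact (one_mul _).trans (zpow_one t)

theorem treeAction_injective_of_position {w : Lamplighter2} (hw : treeAction w = 1)
    (hp : position w = 1) : w = 1 := by
  rw [treeAction_apply, hp] at hw
  have h0 : lampSum (lamps w) = 0 := by
    have h1 : polyTranslation (.ofAdd (lampSum (lamps w))) = polyTranslation 1 := by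
      simpa using hw
    exact polyTranslation_injective h1
  refine lamps_ext ?_ (hp.trans (map_one position).symm)
  rw [← toLamps_lampSum (support_lamps w), h0, map_zero]
  rfl

theorem commutator_position (v w : Lamplighter2) : position (v * w * v⁻¹ * w⁻¹) = 1 := by
  simp only [map_mul, map_inv]
  rw [mul_comm (position v)]
  group

/-- A kernel element `w` has its commutator with `X` in the kernel and at position `1`, hence
trivial; but only elements of position `1` commute with `X`. No separate proof that `t` has infinite
order is needed. -/
theorem treeAction_injective : Function.Injective treeAction := by
  refine (injective_iff_map_eq_one _).mpr fun w hw => ?_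
  have hc : w * Lamplighter2.X * w⁻¹ * Lamplighter2.X⁻¹ = 1 :=
    treeAction_injective_of_position (by simp [hw]) (commutator_position _ _)
  refine treeAction_injective_of_position hw ?_
  have hcomm : w * Lamplighter2.X = Lamplighter2.X * w := by
    rw [← mul_inv_eq_iff_eq_mul, ← mul_inv_eq_one]; exact hc
  by_contra hp
  -- At this index the lamps of `w` cancel, leaving the lit lamp of `X` on one side and an unlit one
  -- on the other.
  have h := congrFun (congrArg lamps hcomm) (position w).toAdd
  rw [lamps_mul, lamps_mul] at h
  simp only [Pi.add_apply, neg_add_cancel] at h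
  have hX0 : lamps Lamplighter2.X 0 = (1, 0) := rfl
  have hX : lamps Lamplighter2.X (position w).toAdd = 0 := by
    simp [lamps, Lamplighter2.X, restrictedWreathProduct.lamp, hp]
  have hpX : position Lamplighter2.X = 1 := rfl
  rw [hX0, hX, hpX, toAdd_one, neg_zero, zero_add, zero_add] at h
  simp at h

theorem treeAction_mem_L (w : Lamplighter2) : treeAction w ∈ L := by
  have hx : x ∈ L := Subgroup.subset_closure (by simp)
  have hy : y ∈ L := Subgroup.subset_closure (by simp)
  have ht : t ∈ L := Subgroup.subset_closure (by simp)
  have hlamp (d : ZMod 2 × ZMod 2) : polyTranslation (.ofAdd (constPair d)) ∈ L := by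
    have h01 : ∀ j : ZMod 2, j = 0 ∨ j = 1 := by decide
    have hd : d = d.1 • (1, 0) + d.2 • (0, 1) := by simp
    have h10 : polyTranslation (.ofAdd (constPair (1, 0))) = x :=
      (treeAction_lamp _).symm.trans treeAction_X
    have h01' : polyTranslation (.ofAdd (constPair (0, 1))) = y :=
      (treeAction_lamp _).symm.trans treeAction_Y
    rw [hd, map_add, ofAdd_add, map_mul]
    refine mul_mem ?_ ?_
    · rcases h01 d.1 with h | h <;> simp [h, h10, hx]
    · rcases h01 d.2 with h | h <;> simp [h, h01', hy]
  refine mul_mem ?_ (zpow_mem ht _)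
  refine finsum_induction (fun v => polyTranslation (.ofAdd v) ∈ L) ?_ ?_ fun k => ?_
  · simp
  · intro u v hu hv
    rw [ofAdd_add, map_mul]
    exact mul_mem hu hv
  · rw [← t_zpow_conj_polyTranslation]
    exact mul_mem (mul_mem (zpow_mem ht _) (hlamp _)) (inv_mem (zpow_mem ht _))

theorem range_treeAction : treeAction.range = L := by
  refine le_antisymm ?_ ?_
  · rintro _ ⟨w, rfl⟩
    exact treeAction_mem_L w
  · refine (Subgroup.closure_le _).mpr ?_
    rintro _ (rfl | rfl | rfl)
    exacts [⟨_, treeAction_X⟩, ⟨_, treeAction_Y⟩, ⟨_, treeAction_T⟩]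

/-- The isomorphism of the lamplighter group with `⟨x, y, t⟩`. -/
noncomputable def lamplighterEquiv : Lamplighter2 ≃* L :=
  (treeAction.ofInjective treeAction_injective).trans (MulEquiv.subgroupCongr range_treeAction)

theorem coe_lamplighterEquiv (w : Lamplighter2) : (lamplighterEquiv w : TreeAut _) = treeAction w :=
  rfl

/-! ### Adjoining the involution `a`. -/

/-- Conjugation inside the lamplighter group preserves the position, whereas conjugation by `a`
would send `1` to `-1`. -/
theorem a_notMem_L : a ∉ L := by
  rw [← range_treeAction]
  rintro ⟨w, hw⟩
  have h : w⁻¹ * Lamplighter2.T * w = Lamplighter2.T⁻¹ := by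
    apply treeAction_injective
    simp only [map_mul, map_inv, hw, treeAction_T, a_conj_t]
  have h1 := congrArg position h
  simp only [map_mul, map_inv, inv_mul_cancel_comm] at h1
  exact absurd (congrArg Multiplicative.toAdd h1) (by decide)

/-- The homomorphism from `ℤ/2` onto `⟨a⟩`. -/
noncomputable def powersOfA : Multiplicative (ZMod 2) →* TreeAut (ZMod 2) :=
  (ZMod.lift 2 ⟨zmultiplesHom (Additive (TreeAut (ZMod 2))) (.ofMul a),
    (zpow_two a).trans a_mul_a⟩).toMultiplicativeLeft

theorem powersOfA_one : powersOfA (.ofAdd 1) = a := by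
  have h := ZMod.lift_coe 2 ⟨zmultiplesHom (Additive (TreeAut (ZMod 2))) (.ofMul a),
    (zpow_two a).trans a_mul_a⟩ 1
  rw [Int.cast_one] at h
  exact h.trans (one_zsmul _)

theorem eq_one_or_eq_ofAdd_one (s : Multiplicative (ZMod 2)) : s = 1 ∨ s = .ofAdd 1 := by
  revert s; decide

theorem a_conj_mem_L {g : TreeAut (ZMod 2)} (hg : g ∈ L) : a * g * a⁻¹ ∈ L := by
  have hx : x ∈ L := Subgroup.subset_closure (by simp)
  have hy : y ∈ L := Subgroup.subset_closure (by simp)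
  have ht : t ∈ L := Subgroup.subset_closure (by simp)
  have h : L ≤ L.comap (MulAut.conj a).toMonoidHom := by
    refine (Subgroup.closure_le _).mpr ?_
    -- The two conventions for conjugation agree because `a` is an involution.
    have ha (g : TreeAut (ZMod 2)) : MulAut.conj a g = a⁻¹ * g * a := by
      rw [MulAut.conj_apply, a_inv]
    rintro _ (rfl | rfl | rfl) <;> change MulAut.conj a _ ∈ L <;> rw [ha]
    · rwa [a_conj_x]
    · rw [a_conj_y]
      exact mul_mem (mul_mem ht hy) (inv_mem ht)
    · rw [a_conj_t]
      exact inv_mem ht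
  exact h hg

theorem powersOfA_mem_normalizer (s : Multiplicative (ZMod 2)) :
    powersOfA s ∈ Subgroup.normalizer (L : Set (TreeAut (ZMod 2))) := by
  rcases eq_one_or_eq_ofAdd_one s with rfl | rfl
  · rw [map_one]; exact one_mem _
  · rw [powersOfA_one, Subgroup.mem_normalizer_iff]
    refine fun g => ⟨a_conj_mem_L, fun hg => ?_⟩
    have h := a_conj_mem_L hg
    rw [a_inv] at h
    have h' : a * (a * g * a) * a = (a * a) * g * (a * a) := by group
    rwa [h', a_mul_a, one_mul, mul_one] at h

/-- The action of `⟨a⟩` on the lamplighter group. -/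
noncomputable def conjAction : Multiplicative (ZMod 2) →* MulAut Lamplighter2 :=
  (MulAut.congr lamplighterEquiv.symm).toMonoidHom.comp
    (L.normalizerMonoidHom.comp (powersOfA.codRestrict _ powersOfA_mem_normalizer))

theorem treeAction_conjAction (s : Multiplicative (ZMod 2)) (w : Lamplighter2) :
    treeAction (conjAction s w) = powersOfA s * treeAction w * (powersOfA s)⁻¹ := by
  rw [← coe_lamplighterEquiv]
  simp [conjAction, MulAut.congr, coe_lamplighterEquiv]

end GroupG
/-! ### Affine automorphisms -/

namespace SeqPair

/-- The term with index `n` of the sequence. -/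
noncomputable def term (n : ℕ) : SeqPair →+ ZMod 2 where
  toFun e := (tail^[n] e).head
  map_zero' := by
    rw [Function.iterate_fixed tail_zero, head_zero]
  map_add' e f := by
    induction n generalizing e f with
    | zero => exact head_add e f
    | succ n ih => simp only [Function.iterate_succ_apply, tail_add, ih]

theorem term_zero (e : SeqPair) : term 0 e = e.head := rfl

theorem term_succ (n : ℕ) (e : SeqPair) : term (n + 1) e = term n e.tail := rfl

/-- The encoding of a sequence by two power series. -/
noncomputable def ofSeq : (ℕ → ZMod 2) →ₗ[ZMod 2] SeqPair where
  toFun u := (PowerSeries.mk fun n => u (2 * n), PowerSeries.mk fun n => u (2 * n + 1))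
  map_add' u w := by ext <;> simp
  map_smul' r u := by ext <;> simp

theorem tail_ofSeq (u : ℕ → ZMod 2) : (ofSeq u).tail = ofSeq fun n => u (n + 1) := by
  ext <;> simp [ofSeq, tail, mul_add]

theorem term_ofSeq (n : ℕ) (u : ℕ → ZMod 2) : term n (ofSeq u) = u n := by
  induction n generalizing u with
  | zero => simp [term_zero, head, ofSeq, ← PowerSeries.coeff_zero_eq_constantCoeff_apply]
  | succ n ih => rw [term_succ, tail_ofSeq, ih]

theorem addTo_wordPrefix (e : SeqPair) (u : ℕ → ZMod 2) (n : ℕ) :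
    e.addTo (wordPrefix u n) = wordPrefix (fun k => u k + term k e) n := by
  induction n generalizing e u with
  | zero => rfl
  | succ n ih =>
    have h := ih e.tail fun k => u (k + 1)
    simp only [wordPrefix, List.ofFn_succ, Fin.val_zero, Fin.val_succ] at h ⊢
    rw [addTo_cons, h]
    rfl

end SeqPair

theorem wordPrefix_succ {X : Type*} (u : ℕ → X) (n : ℕ) :
    wordPrefix u (n + 1) = wordPrefix u n ++ [u n] := by
  simp only [wordPrefix, List.ofFn_succ_last, Fin.val_castSucc, Fin.val_last]

theorem wordPrefix_eq_iff {X : Type*} {u w : ℕ → X} {n : ℕ} :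
    wordPrefix u n = wordPrefix w n ↔ ∀ k < n, u k = w k := by
  rw [wordPrefix, wordPrefix, List.ofFn_inj, funext_iff, Fin.forall_iff]

namespace GroupG

open SeqPair

/-- A transformation of the words that maps the translations of a word to the translations of its
image by the images of the sequences under a linear map. -/
structure HasLinearPart (g : TreeAut (ZMod 2)) (B : SeqPair →ₗ[ZMod 2] SeqPair) : Prop where
  app_nil : g.app [] = []
  app_append (v : List (ZMod 2)) (i : ZMod 2) : ∃ j, g.app (v ++ [i]) = g.app v ++ [j]
  app_addTo (e : SeqPair) (v : List (ZMod 2)) : g.app (e.addTo v) = (B e).addTo (g.app v)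

theorem hasLinearPart_aut (q : FourStates) :
    HasLinearPart (fourStateAutomaton.aut q) (linearPart q) :=
  ⟨rfl, fourStateAutomaton.exists_run_append q, run_addTo q⟩

theorem hasLinearPart_one : HasLinearPart 1 LinearMap.id :=
  ⟨rfl, fun _ i => ⟨i, rfl⟩, fun _ _ => rfl⟩

theorem HasLinearPart.mul {g h : TreeAut (ZMod 2)} {B C : SeqPair →ₗ[ZMod 2] SeqPair}
    (hg : HasLinearPart g B) (hh : HasLinearPart h C) : HasLinearPart (g * h) (C ∘ₗ B) where
  app_nil := by rw [TreeAut.mul_app, hg.app_nil, hh.app_nil]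
  app_append v i := by
    obtain ⟨j, hj⟩ := hg.app_append v i
    rw [TreeAut.mul_app, hj, TreeAut.mul_app]
    exact hh.app_append _ j
  app_addTo e v := by
    rw [TreeAut.mul_app, hg.app_addTo, hh.app_addTo]
    rfl

theorem exists_hasLinearPart {g : TreeAut (ZMod 2)} (hg : g ∈ G) : ∃ B, HasLinearPart g B := by
  refine Subgroup.closure_induction'' (p := fun g _ => ∃ B, HasLinearPart g B) ?_ ?_ ?_ ?_ hg
  · rintro _ ⟨q, rfl⟩
    exact ⟨_, hasLinearPart_aut q⟩
  · rintro _ ⟨q, rfl⟩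
    rw [inv_eq_of_mul_eq_one_left (aut_mul_self q)]
    exact ⟨_, hasLinearPart_aut q⟩
  · exact ⟨_, hasLinearPart_one⟩
  · rintro g h - - ⟨B, hB⟩ ⟨C, hC⟩
    exact ⟨_, hB.mul hC⟩

/-- The matrix rows are the images under `B` of the unit sequences, and the translation vector is
the image of the zero sequence. -/
theorem HasLinearPart.isAffine {g : TreeAut (ZMod 2)} {B : SeqPair →ₗ[ZMod 2] SeqPair}
    (hg : HasLinearPart g B) : IsAffine g := by
  choose b hb using fun n : ℕ => hg.app_append (wordPrefix 0 n) 0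
  have hzero (n : ℕ) : g.app (wordPrefix 0 n) = wordPrefix b n := by
    induction n with
    | zero => exact hg.app_nil
    | succ n ih => rw [wordPrefix_succ, wordPrefix_succ, ← ih]; exact hb n
  have hofSeq (u : ℕ → ZMod 2) (n : ℕ) : (ofSeq u).addTo (wordPrefix 0 n) = wordPrefix u n := by
    rw [addTo_wordPrefix]
    simp [term_ofSeq]
  have happ (u : ℕ → ZMod 2) (n : ℕ) :
      g.app (wordPrefix u n) = wordPrefix (fun k => b k + term k (B (ofSeq u))) n := by
    rw [← hofSeq, hg.app_addTo, hzero, addTo_wordPrefix]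
  -- Prefixes of images depend only on prefixes of arguments.
  have hcausal (u : ℕ → ZMod 2) (j : ℕ) (hu : ∀ i ≤ j, u i = 0) : term j (B (ofSeq u)) = 0 := by
    have h1 : wordPrefix u (j + 1) = wordPrefix 0 (j + 1) :=
      wordPrefix_eq_iff.mpr fun k hk => hu k (Nat.lt_succ_iff.mp hk)
    have h2 := happ u (j + 1)
    rw [h1, hzero, wordPrefix_eq_iff] at h2
    simpa using h2 j j.lt_succ_self
  refine ⟨fun i j => term j (B (ofSeq (Pi.single i 1))), b, fun i j hij => ?_, fun i => ?_,
    fun u n => ?_⟩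
  · exact hcausal _ _ fun k hk => Pi.single_eq_of_ne (by omega) _
  · refine isUnit_iff_ne_zero.mpr fun h0 => ?_
    -- A zero diagonal entry would identify the images of two distinct words.
    have h1 : g.app (wordPrefix (Pi.single i 1) (i + 1)) = g.app (wordPrefix 0 (i + 1)) := by
      rw [happ, hzero, wordPrefix_eq_iff]
      intro k hk
      rcases Nat.lt_succ_iff_lt_or_eq.mp hk with hk | rfl
      · rw [hcausal (Pi.single i 1) k fun l hl => Pi.single_eq_of_ne (by omega) _, add_zero]
      · exact (congrArg (b k + ·) h0).trans (add_zero _)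
    have h2 := wordPrefix_eq_iff.mp (g.unop.injective h1) i i.lt_succ_self
    simp at h2
  · rw [happ, wordPrefix_eq_iff]
    intro j _
    -- No continuity of `B` is assumed; causality discards all coordinates beyond `j`, leaving a
    -- finite sum to which linearity applies.
    have hu : term j (B (ofSeq (u - ∑ i ∈ Finset.range (j + 1), u i • Pi.single i 1))) = 0 := by
      refine hcausal _ _ fun i hi => ?_
      rw [Pi.sub_apply, Finset.sum_apply, Finset.sum_eq_single i]
      · simp
      · intro k _ hk
        simp [Pi.single_eq_of_ne hk.symm]
      · intro h
        exact absurd (Finset.mem_range.mpr (Nat.lt_succ_of_le hi)) h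
    rw [map_sub, map_sub, map_sub, sub_eq_zero] at hu
    simp only [hu, affineMap, map_sum, map_smul, ZMod.map_smul, smul_eq_mul]

/-! ### The semidirect product and the index -/

theorem semidirect_compat (s : Multiplicative (ZMod 2)) :
    treeAction.comp (MulEquiv.toMonoidHom (conjAction s)) =
      (MulEquiv.toMonoidHom (MulAut.conj (powersOfA s))).comp treeAction :=
  MonoidHom.ext (treeAction_conjAction s)

/-- The action of `(⟨x, y⟩ ≀ ⟨t⟩) ⋊ ⟨a⟩` on the binary tree. -/
noncomputable def semidirectAction :
    (Lamplighter2 ⋊[conjAction] Multiplicative (ZMod 2)) →* TreeAut (ZMod 2) :=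
  SemidirectProduct.lift treeAction powersOfA semidirect_compat

theorem semidirectAction_apply (w : Lamplighter2 ⋊[conjAction] Multiplicative (ZMod 2)) :
    semidirectAction w = treeAction w.left * powersOfA w.right := rfl

/-- A kernel element with nontrivial second component would place `a` in `L`. -/
theorem semidirectAction_injective : Function.Injective semidirectAction := by
  refine (injective_iff_map_eq_one _).mpr fun w hw => ?_
  rw [semidirectAction_apply] at hw
  rcases eq_one_or_eq_ofAdd_one w.right with h | h
  · rw [h, map_one, mul_one] at hw
    exact SemidirectProduct.ext (treeAction_injective (hw.trans (map_one _).symm)) h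
  · rw [h, powersOfA_one] at hw
    refine absurd ?_ a_notMem_L
    rw [eq_inv_of_mul_eq_one_right hw]
    exact inv_mem (treeAction_mem_L _)

theorem aut_mem_G (q : FourStates) : fourStateAutomaton.aut q ∈ G :=
  Subgroup.subset_closure ⟨q, rfl⟩

theorem L_le_G : L ≤ G := by
  refine (Subgroup.closure_le _).mpr ?_
  rintro _ (rfl | rfl | rfl)
  · exact mul_mem (aut_mem_G .a) (aut_mem_G .b)
  · exact mul_mem (aut_mem_G .c) (aut_mem_G .d)
  · exact mul_mem (aut_mem_G .a) (aut_mem_G .c)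

theorem range_semidirectAction : semidirectAction.range = G := by
  have ha : a ∈ semidirectAction.range :=
    ⟨SemidirectProduct.inr (.ofAdd 1), by simp [semidirectAction, powersOfA_one]⟩
  have hL : L ≤ semidirectAction.range := by
    rw [← range_treeAction]
    rintro _ ⟨w, rfl⟩
    exact ⟨SemidirectProduct.inl w, by simp [semidirectAction]⟩
  have hx : x ∈ semidirectAction.range := hL (Subgroup.subset_closure (by simp))
  have hy : y ∈ semidirectAction.range := hL (Subgroup.subset_closure (by simp))
  have ht : t ∈ semidirectAction.range := hL (Subgroup.subset_closure (by simp))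
  have hc : c ∈ semidirectAction.range := by
    have h : c = a * t := by rw [t, ← mul_assoc, a_mul_a, one_mul]
    exact h ▸ mul_mem ha ht
  refine le_antisymm ?_ ((Subgroup.closure_le _).mpr ?_)
  · rintro _ ⟨w, rfl⟩
    rw [semidirectAction_apply]
    refine mul_mem (L_le_G (treeAction_mem_L _)) ?_
    rcases eq_one_or_eq_ofAdd_one w.right with h | h <;> rw [h]
    · rw [map_one]; exact one_mem _
    · rw [powersOfA_one]; exact aut_mem_G .a
  · rintro _ ⟨q, rfl⟩
    cases q
    · exact ha
    · change b ∈ _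
      rw [b_eq, ← x_eq]
      exact mul_mem ha hx
    · exact hc
    · change d ∈ _
      rw [d_eq, ← y_eq]
      exact mul_mem hc hy

/-- The isomorphism of `(⟨x, y⟩ ≀ ⟨t⟩) ⋊ ⟨a⟩` with the automaton group. -/
noncomputable def semidirectEquiv :
    (Lamplighter2 ⋊[conjAction] Multiplicative (ZMod 2)) ≃* G :=
  (semidirectAction.ofInjective semidirectAction_injective).trans
    (MulEquiv.subgroupCongr range_semidirectAction)

theorem coe_semidirectEquiv (w : Lamplighter2 ⋊[conjAction] Multiplicative (ZMod 2)) :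
    (semidirectEquiv w : TreeAut _) = semidirectAction w := rfl

theorem relIndex_L_G : L.relIndex G = 2 := by
  refine Subgroup.relIndex_eq_two_iff.mpr ⟨a, aut_mem_G .a, fun g hg => ?_⟩
  rw [← range_semidirectAction] at hg
  obtain ⟨w, rfl⟩ := hg
  rw [semidirectAction_apply]
  rcases eq_one_or_eq_ofAdd_one w.right with h | h
  · rw [h, map_one, mul_one, Subgroup.mul_mem_cancel_left _ (treeAction_mem_L _)]
    exact Or.inr ⟨treeAction_mem_L _, a_notMem_L⟩
  · rw [h, powersOfA_one, mul_assoc, a_mul_a, mul_one,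
      Subgroup.mul_mem_cancel_left _ (treeAction_mem_L _)]
    exact Or.inl ⟨treeAction_mem_L _, a_notMem_L⟩

theorem conjAction_eq {v w : Lamplighter2}
    (h : a⁻¹ * treeAction v * a = treeAction w) : conjAction (.ofAdd 1) v = w := by
  apply treeAction_injective
  rw [treeAction_conjAction, powersOfA_one, ← h, a_inv]

end GroupG

theorem mainTheorem2 :
    -- `a` acts on `x`, `y`, `t` as claimed, where `g ^ h = h⁻¹ * g * h`
    (GroupG.a⁻¹ * GroupG.x * GroupG.a = GroupG.x ∧
      GroupG.a⁻¹ * GroupG.y * GroupG.a = GroupG.t * GroupG.y * GroupG.t⁻¹ ∧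
      GroupG.a⁻¹ * GroupG.t * GroupG.a = GroupG.t⁻¹) ∧
    -- `⟨x, y, t⟩` is the rank 2 lamplighter group `⟨x, y⟩ ≀ ⟨t⟩`
    (∃ Ψ : Lamplighter2 ≃* GroupG.L,
      (Ψ Lamplighter2.X : TreeAut (ZMod 2)) = GroupG.x ∧
      (Ψ Lamplighter2.Y : TreeAut (ZMod 2)) = GroupG.y ∧
      (Ψ Lamplighter2.T : TreeAut (ZMod 2)) = GroupG.t) ∧
    -- the whole group is the semidirect product `(⟨x, y⟩ ≀ ⟨t⟩) ⋊ ⟨a⟩`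
    (∃ φ : Multiplicative (ZMod 2) →* MulAut Lamplighter2,
      φ (Multiplicative.ofAdd 1) Lamplighter2.X = Lamplighter2.X ∧
      φ (Multiplicative.ofAdd 1) Lamplighter2.Y =
        Lamplighter2.T * Lamplighter2.Y * Lamplighter2.T⁻¹ ∧
      φ (Multiplicative.ofAdd 1) Lamplighter2.T = Lamplighter2.T⁻¹ ∧
      ∃ Φ : (Lamplighter2 ⋊[φ] Multiplicative (ZMod 2)) ≃* GroupG.G,
        (Φ (SemidirectProduct.inl Lamplighter2.X) : TreeAut (ZMod 2)) = GroupG.x ∧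
        (Φ (SemidirectProduct.inl Lamplighter2.Y) : TreeAut (ZMod 2)) = GroupG.y ∧
        (Φ (SemidirectProduct.inl Lamplighter2.T) : TreeAut (ZMod 2)) = GroupG.t ∧
        (Φ (SemidirectProduct.inr (Multiplicative.ofAdd 1)) : TreeAut (ZMod 2)) = GroupG.a) ∧
    -- `⟨x, y, t⟩` is a subgroup of index 2 that consists of affine automorphisms
    GroupG.L ≤ GroupG.G ∧ GroupG.L.relIndex GroupG.G = 2 ∧ ∀ g ∈ GroupG.L, IsAffine g := by
  refine ⟨⟨GroupG.a_conj_x, GroupG.a_conj_y, GroupG.a_conj_t⟩,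
    ⟨GroupG.lamplighterEquiv, GroupG.treeAction_X, GroupG.treeAction_Y, GroupG.treeAction_T⟩,
    ⟨GroupG.conjAction, GroupG.conjAction_eq ?_, GroupG.conjAction_eq ?_, GroupG.conjAction_eq ?_,
      GroupG.semidirectEquiv, ?_, ?_, ?_, ?_⟩,
    GroupG.L_le_G, GroupG.relIndex_L_G, fun g hg => ?_⟩
  · rw [GroupG.treeAction_X, GroupG.a_conj_x]
  · simp only [map_mul, map_inv, GroupG.treeAction_Y, GroupG.treeAction_T, GroupG.a_conj_y]
  · simp only [map_inv, GroupG.treeAction_T, GroupG.a_conj_t]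
  · simp [GroupG.coe_semidirectEquiv, GroupG.semidirectAction, GroupG.treeAction_X]
  · simp [GroupG.coe_semidirectEquiv, GroupG.semidirectAction, GroupG.treeAction_Y]
  · simp [GroupG.coe_semidirectEquiv, GroupG.semidirectAction, GroupG.treeAction_T]
  · simp [GroupG.coe_semidirectEquiv, GroupG.semidirectAction, GroupG.powersOfA_one]
  · obtain ⟨B, hB⟩ := GroupG.exists_hasLinearPart (GroupG.L_le_G hg)
    exact hB.isAffine
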